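/- Let $S$ be a commutative ring and let $G$ be a finite group acting on $S$ from the right by ring automorphisms, $s\mapsto s^g$; put $R=S^G$, let $f:R\hookrightarrow S$ be the inclusion, and assume that there is $x\in S$ with $\sum_{g\in G}x^g=1$. Let $n\ge 0$. For a commutative ring $A$, let $\mathbf P_n(A)$ be the set of isomorphism classes $\langle Q\rangle$ of finitely generated projective $A$-modules $Q$ of constant rank $n$, pointed by $\langle A^n\rangle$, and let $\mathbf P_n(f):\mathbf P_n(R)\to\mathbf P_n(S)$ be the map $\langle Q\rangle\mapsto\langle S\otimes_R Q\rangle$. For a group $\Gamma$ acting from the right on a group $X$, let $H^1(\Gamma,X)$ be the set of all maps $d:\Gamma\to X$ with $d(gg')=d(g)^{g'}d(g')$ for all $g,g'\in\Gamma$ ($1$-cocycles), modulo the equivalence relation $d\sim e\iff\exists x\in X\ \forall g\in\Gamma:\ d(g)=x^g e(g)x^{-1}$; it is pointed by the class of $d\equiv 1$. The kernel of a map of pointed sets is the preimage of the distinguished element. For a maximal ideal $\mathfrak M$ of $S$ let $G^Z(\mathfrak M)=\{g\in G:\mathfrak M^g=\mathfrak M\}$ and $G^T(\mathfrak M)=\{g\in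 G: s^g-s\in\mathfrak M\text{ for all }s\in S\}$ be its decomposition and inertia groups. For a subgroup $H\le G$ let $J(H)$ be the intersection of all maximal ideals $\mathfrak M$ of $S$ with $H\subseteq G^T(\mathfrak M)$ (so $J(H)=S$ if there are none), and let $S_H=S/J(H)$. Consider the maps given by restriction of cocycles to a subgroup and reduction of matrix entries modulo an ideal, $$\rho'_{\mathfrak M,n}:H^1(G,\mathrm{GL}_n(S))\to H^1(G^Z(\mathfrak M),\mathrm{GL}_n(S/\mathfrak M)),$$ $$\rho_{\mathfrak M,n}:H^1(G,\mathrm{GL}_n(S))\to H^1(G^T(\mathfrak M),\mathrm{GL}_n(S/\mathfrak M)),\qquad \rho_{H,n}:H^1(G,\mathrm{GL}_n(S))\to H^1(H,\mathrm{GL}_n(S_H)).$$ Then there is an isomorphism of pointed sets $$\Psi:\operatorname{Ker}\mathbf P_n(f)\ \xrightarrow{\ \cong\ }\ \bigcap_{\mathfrak M\in\operatorname{Max}S}\operatorname{Ker}\rho'_{\mathfrak M,n},$$ and it can be chosen as follows: whenever $\langle Q\rangle\in\operatorname{Ker}\mathbf P_n(f)$ and $b_1,\dots,b_n$ is a basis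 of the $S$-module $S\otimes_RQ$, there is a cocycle $d:G\to\mathrm{GL}_n(S)$ with $b_i\cdot g=\sum_j d(g)_{ij}\,b_j$ for all $g\in G$ and all $i$, where $(s\otimes q)\cdot g=s^g\otimes q$, and $\Psi(\langle Q\rangle)$ is the class of $d$. Moreover, inside $H^1(G,\mathrm{GL}_n(S))$, $$\bigcap_{\mathfrak M\in\operatorname{Max}S}\operatorname{Ker}\rho'_{\mathfrak M,n}=\bigcap_{\mathfrak M\in\operatorname{Max}S}\operatorname{Ker}\rho_{\mathfrak M,n}=\bigcap_{C\le G\text{ cyclic}}\operatorname{Ker}\rho_{C,n}=\bigcap_{H\le G}\operatorname{Ker}\rho_{H,n}.$$ -/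

import Mathlib

open scoped TensorProduct Pointwise

noncomputable section

/-! ## Nonabelian first cohomology, for groups acting on the right -/

namespace NonabH1

universe v w

/-- A `G`-group is a group `X` with a right action of `G` by group endomorphisms (which are then
automorphisms), given as a monoid homomorphism from `Gᵐᵒᵖ`; so `x ^ g` is `φ (.op g) x`. -/
abbrev RightAction (G : Type v) (X : Type w) [Group G] [Group X] : Type (max v w) :=
  Gᵐᵒᵖ →* Monoid.End X

section Basic

variable {G : Type v} {X : Type w} [Group G] [Group X] (φ : RightAction G X)

/-- `1`-cocycles: maps `d` with `d (g g') = d(g) ^ {g'} d(g')`. -/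
abbrev Z1 : Type (max v w) :=
  {d : G → X // ∀ g g' : G, d (g * g') = φ (.op g') (d g) * d g'}

/-- Cohomologous cocycles: `d(g) = x ^ g e(g) x⁻¹` for some `x` and all `g`. -/
def Cohomologous (d e : Z1 φ) : Prop :=
  ∃ x : X, ∀ g : G, d.1 g = φ (.op g) x * e.1 g * x⁻¹

theorem cohomologous_equivalence : Equivalence (Cohomologous φ) where
  refl d := ⟨1, fun g => by simp⟩
  symm := by
    rintro d e ⟨x, hx⟩
    exact ⟨x⁻¹, fun g => by rw [hx g, map_inv]; group⟩
  trans := by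
    rintro d e f ⟨x, hx⟩ ⟨y, hy⟩
    exact ⟨x * y, fun g => by rw [hx g, hy g, map_mul]; group⟩

/-- Being cohomologous, as a setoid on the cocycles. -/
def setoid : Setoid (Z1 φ) := ⟨Cohomologous φ, cohomologous_equivalence φ⟩

/-- The cohomology set `H¹(G, X)`. -/
def H1 : Type (max v w) := Quotient (setoid φ)

/-- The class of a cocycle. -/
def H1.mk (d : Z1 φ) : H1 φ := Quotient.mk (setoid φ) d

/-- The unit cocycle. -/
def Z1.unit : Z1 φ := ⟨fun _ => 1, fun _ _ => by simp⟩

/-- The distinguished element of `H¹(G, X)`: the class of the unit cocycle. -/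
def H1.base : H1 φ := H1.mk φ (Z1.unit φ)

end Basic

section Functoriality

universe v' w'

variable {G : Type v} {X : Type w} [Group G] [Group X] {φ : RightAction G X}
  {G' : Type v'} {X' : Type w'} [Group G'] [Group X'] {φ' : RightAction G' X'}

/-- The map `d ↦ f ∘ d ∘ α` on cocycles induced by a homomorphism `α : G → G'` and a group
homomorphism `f : X' → X` compatible with the actions of `G`. -/
def Z1.map (α : G →* G') (f : X' →* X)
    (hf : ∀ (g : G) (x : X'), f (φ' (.op (α g)) x) = φ (.op g) (f x)) (d : Z1 φ') : Z1 φ :=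
  ⟨fun g => f (d.1 (α g)), fun g g' => by
    change f (d.1 (α (g * g'))) = φ (.op g') (f (d.1 (α g))) * f (d.1 (α g'))
    rw [map_mul, d.2, map_mul, hf]⟩

/-- The induced map `H¹(G', X') → H¹(G, X)`. -/
def H1.map (α : G →* G') (f : X' →* X)
    (hf : ∀ (g : G) (x : X'), f (φ' (.op (α g)) x) = φ (.op g) (f x)) : H1 φ' → H1 φ :=
  Quotient.map' (s₁ := setoid φ') (s₂ := setoid φ) (Z1.map α f hf) (by
    rintro d e ⟨x, hx⟩
    refine ⟨f x, fun g => ?_⟩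
    change f (d.1 (α g)) = _ * f (e.1 (α g)) * _
    rw [hx, map_mul, map_mul, map_inv, hf])

end Functoriality

end NonabH1

/-! ## Isomorphism classes of projective modules of constant rank -/

namespace ConstRankProj

universe u

/-- Finitely generated projective modules of constant rank `n` over `A`. -/
structure Mod (A : Type u) [CommRing A] (n : ℕ) where
  /-- the underlying type -/
  carrier : Type u
  [addCommGroup : AddCommGroup carrier]
  [module : Module A carrier]
  [finite : Module.Finite A carrier]
  [projective : Module.Projective A carrier]
  rank_eq : ∀ p : PrimeSpectrum A, Module.rankAtStalk carrier p = n

attribute [instance] Mod.addCommGroup Mod.module Mod.finite Mod.projective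

/-- Isomorphism of modules, as a setoid. -/
def setoid (A : Type u) [CommRing A] (n : ℕ) : Setoid (Mod A n) where
  r M N := Nonempty (M.carrier ≃ₗ[A] N.carrier)
  iseqv :=
    { refl := fun M => ⟨LinearEquiv.refl A M.carrier⟩
      symm := fun ⟨e⟩ => ⟨e.symm⟩
      trans := fun ⟨e⟩ ⟨f⟩ => ⟨e.trans f⟩ }

/-- The set `P_n(A)` of isomorphism classes of f.g. projective `A`-modules of constant rank `n`.
(Every f.g. module is isomorphic to one in the universe of `A`.) -/
def P (n : ℕ) (A : Type u) [CommRing A] : Type (u + 1) := Quotient (setoid A n)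

/-- The isomorphism class of a module. -/
def P.mk {n : ℕ} {A : Type u} [CommRing A] (M : Mod A n) : P n A := Quotient.mk (setoid A n) M

/-- The free module `A ^ n`. -/
def Mod.free (A : Type u) [CommRing A] (n : ℕ) : Mod A n where
  carrier := Fin n → A
  rank_eq p := by
    have : Nontrivial A := p.nontrivial
    simp

/-- The distinguished element of `P_n(A)`: the class of `A ^ n`. -/
def P.base (n : ℕ) (A : Type u) [CommRing A] : P n A := P.mk (Mod.free A n)

variable {n : ℕ} {A B : Type u} [CommRing A] [CommRing B] [Algebra A B]

/-- Extension of scalars on modules of constant rank. -/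
def Mod.baseChange (B : Type u) [CommRing B] [Algebra A B] (M : Mod A n) : Mod B n where
  carrier := B ⊗[A] M.carrier
  rank_eq p := by rw [Module.rankAtStalk_baseChange, M.rank_eq]

/-- The map `P_n(A) → P_n(B)` induced by extension of scalars along `A → B`. -/
def P.map (n : ℕ) (A B : Type u) [CommRing A] [CommRing B] [Algebra A B] : P n A → P n B :=
  Quotient.map' (s₁ := setoid A n) (s₂ := setoid B n) (Mod.baseChange B) (by
    rintro M N ⟨e⟩
    exact ⟨LinearEquiv.baseChange A B M.carrier N.carrier e⟩)

theorem P.map_base (n : ℕ) (A B : Type u) [CommRing A] [CommRing B] [Algebra A B] :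
    P.map n A B (P.base n A) = P.base n B :=
  Quotient.sound (s := setoid B n) ⟨TensorProduct.piScalarRight A B B (Fin n)⟩

end ConstRankProj

/-! ## Group actions on a commutative ring and restriction-reduction maps

A right action `s ↦ s ^ g` of `G` on `S` by ring automorphisms is a `MulSemiringAction` of `Gᵐᵒᵖ`,
with `s ^ g = MulOpposite.op g • s`. -/

namespace InvariantRing

open NonabH1

universe u v

/-- The entrywise right action on `GL_n` coming from a right action on a ring. -/
def glAction (n : ℕ) {G : Type v} [Group G] {A : Type u} [CommRing A] (σ : Gᵐᵒᵖ →* (A →+* A)) :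
    RightAction G (GL (Fin n) A) where
  toFun g := Matrix.GeneralLinearGroup.map (σ g)
  map_one' := by rw [map_one]; exact Matrix.GeneralLinearGroup.map_id
  map_mul' g h := by
    rw [map_mul]
    exact (Matrix.GeneralLinearGroup.map_comp (σ h) (σ g)).symm

variable (G : Type v) [Group G] (S : Type u) [CommRing S] [MulSemiringAction Gᵐᵒᵖ S]

/-- The given action of `G` on `S`, as a homomorphism. -/
def ringAction : Gᵐᵒᵖ →* (S →+* S) where
  toFun g := MulSemiringAction.toRingHom Gᵐᵒᵖ S g
  map_one' := by ext s; exact one_smul _ s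
  map_mul' g h := by ext s; exact mul_smul g h s

/-- The ring of invariants `R = S ^ G`. -/
abbrev Inv : Subring S := FixedPoints.subring S Gᵐᵒᵖ

variable {S}

/-- The decomposition group `{g : M ^ g = M}`. -/
def decompositionGroup (M : Ideal S) : Subgroup G := (MulAction.stabilizer Gᵐᵒᵖ M).unop

/-- The inertia group `{g : s ^ g - s ∈ M for all s}`. -/
def inertiaGroup (M : Ideal S) : Subgroup G := (M.inertia Gᵐᵒᵖ).unop

variable {G}

theorem mem_decompositionGroup {M : Ideal S} {g : G} :
    g ∈ decompositionGroup G M ↔ MulOpposite.op g • M = M := Iff.rfl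

theorem mem_inertiaGroup {M : Ideal S} {g : G} :
    g ∈ inertiaGroup G M ↔ ∀ s : S, MulOpposite.op g • s - s ∈ M := Iff.rfl

/-- The ideal `J(H)`: the intersection of all maximal ideals whose inertia group contains `H`. -/
def J (H : Subgroup G) : Ideal S :=
  ⨅ (M : MaximalSpectrum S) (_ : H ≤ inertiaGroup G M.asIdeal), M.asIdeal

/-- The ideal `I` is stable under the action of the subgroup `H`. -/
def Stable (H : Subgroup G) (I : Ideal S) : Prop :=
  ∀ g ∈ H, ∀ s ∈ I, MulOpposite.op g • s ∈ I

theorem stable_of_le_inertiaGroup {H : Subgroup G} {I : Ideal S} (h : H ≤ inertiaGroup G I) :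
    Stable H I := fun g hg s hs => by
  simpa using I.add_mem (mem_inertiaGroup.mp (h hg) s) hs

theorem stable_decompositionGroup (M : Ideal S) : Stable (decompositionGroup G M) M :=
  fun g hg s hs => by
    have h : MulOpposite.op g • s ∈ MulOpposite.op g • M := Ideal.mem_map_of_mem _ hs
    rwa [mem_decompositionGroup.mp hg] at h

theorem stable_inertiaGroup (M : Ideal S) : Stable (inertiaGroup G M) M :=
  stable_of_le_inertiaGroup le_rfl

theorem le_inertiaGroup_J (H : Subgroup G) : H ≤ inertiaGroup G (J H : Ideal S) :=
  fun g hg => mem_inertiaGroup.mpr fun s => by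
    simp only [J, Ideal.mem_iInf]
    exact fun M hM => mem_inertiaGroup.mp (hM hg) s

theorem stable_J (H : Subgroup G) : Stable H (J H : Ideal S) :=
  stable_of_le_inertiaGroup (le_inertiaGroup_J H)

/-- The action of `H` on `S / I` for an `H`-stable ideal `I`. -/
def quotAction (H : Subgroup G) (I : Ideal S) (hI : Stable H I) :
    (H : Type v)ᵐᵒᵖ →* ((S ⧸ I) →+* (S ⧸ I)) where
  toFun h := Ideal.quotientMap I (ringAction G S (.op (h.unop : G)))
    fun s hs => hI _ h.unop.2 s hs
  map_one' := by
    ext s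
    exact congrArg (Ideal.Quotient.mk I) (one_smul Gᵐᵒᵖ s)
  map_mul' g h := by
    ext s
    exact congrArg (Ideal.Quotient.mk I)
      (mul_smul (MulOpposite.op (g.unop : G)) (MulOpposite.op (h.unop : G)) s)

variable (S) in
/-- `H¹(G, GL_n(S))`. -/
abbrev H1GL (G : Type v) [Group G] [MulSemiringAction Gᵐᵒᵖ S] (n : ℕ) : Type (max v u) :=
  H1 (glAction n (ringAction G S))

/-- The restriction-reduction map `H¹(G, GL_n(S)) → H¹(H, GL_n(S / I))` for a subgroup `H` of `G`
and an `H`-stable ideal `I` of `S`. -/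
def resRed (n : ℕ) (H : Subgroup G) (I : Ideal S) (hI : Stable H I) :
    H1GL S G n → H1 (glAction n (quotAction H I hI)) :=
  H1.map H.subtype (Matrix.GeneralLinearGroup.map (Ideal.Quotient.mk I)) (by
    intro g x
    apply Matrix.GeneralLinearGroup.ext
    intro i j
    rfl)

/-- The kernel of the restriction-reduction map: the preimage of the distinguished element. -/
def kerResRed (n : ℕ) (H : Subgroup G) (I : Ideal S) (hI : Stable H I) : Set (H1GL S G n) :=
  {a | resRed n H I hI a = H1.base _}

/-- The kernel of `ρ'_{M,n} : H¹(G, GL_n(S)) → H¹(G^Z(M), GL_n(S / M))`. -/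
def kerRhoDecomposition (n : ℕ) (M : MaximalSpectrum S) : Set (H1GL S G n) :=
  kerResRed n (decompositionGroup G M.asIdeal) M.asIdeal (stable_decompositionGroup M.asIdeal)

/-- The kernel of `ρ_{M,n} : H¹(G, GL_n(S)) → H¹(G^T(M), GL_n(S / M))`. -/
def kerRhoInertia (n : ℕ) (M : MaximalSpectrum S) : Set (H1GL S G n) :=
  kerResRed n (inertiaGroup G M.asIdeal) M.asIdeal (stable_inertiaGroup M.asIdeal)

/-- The kernel of `ρ_{H,n} : H¹(G, GL_n(S)) → H¹(H, GL_n(S_H))`, where `S_H = S / J(H)`. -/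
def kerRhoSubgroup (n : ℕ) (H : Subgroup G) : Set (H1GL S G n) :=
  kerResRed n H (J H) (stable_J H)

variable (G S) in
/-- The kernel of `P_n(R) → P_n(S)`, `R = S ^ G`: the preimage of the distinguished element. -/
def kerP (n : ℕ) : Set (ConstRankProj.P n (Inv G S)) :=
  {q | ConstRankProj.P.map n (Inv G S) S q = ConstRankProj.P.base n S}

variable (G S) in
/-- The distinguished element of the kernel of `P_n(R) → P_n(S)`. -/
def kerPBase (n : ℕ) : kerP G S n :=
  ⟨ConstRankProj.P.base n (Inv G S), ConstRankProj.P.map_base n (Inv G S) S⟩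

/-- The right action of `g` on `S ⊗_R Q`, `(s ⊗ q) g = s ^ g ⊗ q`, for an `R`-module `Q`. -/
def tensorAction (g : G) (Q : Type u) [AddCommGroup Q] [Module (Inv G S) Q] :
    S ⊗[Inv G S] Q →ₗ[Inv G S] S ⊗[Inv G S] Q :=
  (DistribSMul.toLinearMap (Inv G S) S (MulOpposite.op g)).rTensor Q

/-- The cocycle `d` describes the `G`-action on `S ⊗_R Q` in the `S`-basis `b`:
`b_i g = ∑_j d(g)_{ij} b_j` for all `g` and `i`. -/
def DescribesAction {n : ℕ} {Q : Type u} [AddCommGroup Q] [Module (Inv G S) Q]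
    (b : Module.Basis (Fin n) S (S ⊗[Inv G S] Q)) (d : Z1 (glAction n (ringAction G S))) : Prop :=
  ∀ (g : G) (i : Fin n),
    tensorAction g Q (b i) = ∑ j, (d.1 g : Matrix (Fin n) (Fin n) S) i j • b j

end InvariantRing

end

/-!
A cocycle `d : G → GL_n(S)` is the same thing as a semilinear right action of `G` on row vectors,
`v ↦ v ^ g d(g)`, and the whole statement turns on one property of `d`, called `Spans d` below:
the invariant vectors of this action generate `S ^ n` over `S`.

* *Modules versus cocycles.* In a basis of `S ⊗ Q` the action of `G` is described by a cocycle, and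
  the elements `1 ⊗ q` show that it satisfies `Spans`. An element `x` of trace `1` gives the map
  `s ⊗ q ↦ tr(x s) q`, which identifies `Q` with the invariants of `S ⊗ Q`. Hence equivariant
  isomorphisms descend, and cohomologous cocycles come from isomorphic modules
  (`DescribesAction.cohomologous`, `DescribesAction.nonempty_linearEquiv`). Conversely, suppose
  `Spans d`, and choose finitely many invariant vectors that generate. A section of the resulting
  surjection `S ^ m → S ^ n` can be averaged with weight `x` to an equivariant one. This makes the
  module `Q` of invariants a direct summand of `R ^ m` and the map `S ⊗ Q → S ^ n` an isomorphism
  (`Spans.exists_describesAction`); the rank is constant because `Spec S → Spec R` is surjective.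

* *Local conditions.* If `Spans d`, then `n` invariant vectors reduce to a basis of `(S / M) ^ n`;
  the matrix formed by them trivializes `d` modulo `M` on the decomposition group
  (`Spans.mem_kerRhoDecomposition`). Restricting further, `d` is trivial modulo `M` on the inertia
  group. If conversely this holds for all `M` and `Spans d` fails, then some nonzero functional
  `S ^ n → S / M` vanishes on all traces `∑ s ^ g e_i d(g)`. That is a linear relation between the
  characters `s ↦ s ^ g mod M`; it is excluded by Dedekind's lemma, since the order of the inertia
  group is invertible modulo `M` (`spans_of_mem_inertia`).

* *Subgroups.* A group acting trivially on `S / I` has only the trivial coboundary modulo `I`, so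
  the kernels for inertia groups, cyclic subgroups and all subgroups are given by congruences
  `d(g) ≡ 1`, and their intersections are visibly equal.
-/

open scoped TensorProduct Pointwise

noncomputable section

namespace InvariantRing

open NonabH1 Matrix

universe u v

variable {G : Type v} [Group G] {S : Type u} [CommRing S] [MulSemiringAction Gᵐᵒᵖ S] {n : ℕ}

/-! ### Cocycles and twisted actions -/

variable (S G n) in
/-- `1`-cocycles on `G` with values in `GL_n(S)`. -/
abbrev GLCocycle : Type (max v u) := Z1 (glAction n (ringAction G S))

/-- The matrix `d(g)` of a cocycle. -/
abbrev mat (d : GLCocycle G S n) (g : G) : Matrix (Fin n) (Fin n) S := (d.1 g).1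

theorem mat_mul (d : GLCocycle G S n) (g h : G) :
    mat d (g * h) = (mat d g).map (MulOpposite.op h • ·) * mat d h := by
  rw [mat, d.2]; rfl

theorem mat_one (d : GLCocycle G S n) : mat d 1 = 1 := by
  have h : d.1 1 = 1 := by
    have := d.2 1 1
    rw [mul_one, MulOpposite.op_one, map_one] at this
    simpa using this
  rw [mat, h]; rfl

theorem op_smul_vecMul {m : ℕ} (g : Gᵐᵒᵖ) (v : Fin m → S) (A : Matrix (Fin m) (Fin n) S) :
    g • (v ᵥ* A) = (g • v) ᵥ* A.map (g • ·) := by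
  ext j
  simp [vecMul, dotProduct, Finset.smul_sum, smul_mul']

theorem op_smul_smul_vec (g : Gᵐᵒᵖ) (s : S) (v : Fin n → S) :
    g • (s • v) = (g • s) • (g • v) := by
  ext j
  simp [smul_mul']

/-- The right action of `g` on row vectors twisted by a cocycle: `v ↦ v ^ g d(g)`. -/
def twist (d : GLCocycle G S n) (g : G) : (Fin n → S) →+ (Fin n → S) where
  toFun v := (MulOpposite.op g • v) ᵥ* mat d g
  map_zero' := by simp
  map_add' v w := by simp [add_vecMul]

theorem twist_apply (d : GLCocycle G S n) (g : G) (v : Fin n → S) :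
    twist d g v = (MulOpposite.op g • v) ᵥ* mat d g := rfl

theorem twist_smul (d : GLCocycle G S n) (g : G) (s : S) (v : Fin n → S) :
    twist d g (s • v) = (MulOpposite.op g • s) • twist d g v := by
  rw [twist_apply, op_smul_smul_vec, smul_vecMul, twist_apply]

theorem twist_twist (d : GLCocycle G S n) (g h : G) (v : Fin n → S) :
    twist d h (twist d g v) = twist d (g * h) v := by
  simp only [twist_apply]
  rw [op_smul_vecMul, vecMul_vecMul, ← mat_mul, smul_smul, ← MulOpposite.op_mul]

theorem twist_one (d : GLCocycle G S n) (v : Fin n → S) : twist d 1 v = v := by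
  simp [twist_apply, mat_one]

theorem op_smul_single (g : Gᵐᵒᵖ) (i : Fin n) :
    g • (Pi.single i 1 : Fin n → S) = Pi.single i 1 := by
  ext j
  by_cases h : j = i
  · subst h; simp
  · simp [Pi.single_eq_of_ne h]

theorem twist_single (d : GLCocycle G S n) (g : G) (i : Fin n) :
    twist d g (Pi.single i 1) = mat d g i := by
  rw [twist_apply, op_smul_single, single_one_vecMul]; rfl

/-- The `S ^ G`-module of row vectors fixed by the action twisted by a cocycle. -/
def invariants (d : GLCocycle G S n) : Submodule (Inv G S) (Fin n → S) where
  carrier := {v | ∀ g, twist d g v = v}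
  zero_mem' g := map_zero _
  add_mem' hv hw g := by rw [map_add, hv g, hw g]
  smul_mem' r v hv g := by
    change twist d g ((r : S) • v) = (r : S) • v
    rw [twist_smul, hv g, r.2 (.op g)]

/-- The invariant vectors of the twisted action generate `S ^ n` over `S`. For a finite group with
an element of trace `1` this characterizes the cocycles coming from projective modules. -/
def Spans (d : GLCocycle G S n) : Prop :=
  Submodule.span S (invariants d : Set (Fin n → S)) = ⊤

theorem sum_twist_mem_invariants [Fintype G] (d : GLCocycle G S n) (v : Fin n → S) :
    ∑ g, twist d g v ∈ invariants d := fun h => by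
  simp_rw [map_sum, twist_twist]
  exact Fintype.sum_equiv (Equiv.mulRight h) _ _ fun g => rfl

/-! ### Kernels of the restriction-reduction maps -/

/-- Membership in the kernel is triviality of the cocycle modulo `I`: it equals `x ^ g x⁻¹` on `H`
for some `x`. -/
theorem mk_mem_kerResRed {d : GLCocycle G S n} {H : Subgroup G} {I : Ideal S} {hI : Stable H I} :
    H1.mk _ d ∈ kerResRed n H I hI ↔ ∃ x : GL (Fin n) (S ⧸ I), ∀ g : H,
      Matrix.GeneralLinearGroup.map (Ideal.Quotient.mk I) (d.1 g) =
        glAction n (quotAction H I hI) (.op g) x * x⁻¹ := by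
  constructor
  · intro h
    obtain ⟨x, hx⟩ := Quotient.exact (s := NonabH1.setoid _) h
    exact ⟨x, fun g => (hx g).trans (congrArg (· * x⁻¹) (mul_one _))⟩
  · rintro ⟨x, hx⟩
    exact Quotient.sound (s := NonabH1.setoid _)
      ⟨x, fun g => (hx g).trans (congrArg (· * x⁻¹) (mul_one _).symm)⟩

/-- If `H` acts trivially on `S / I`, a cocycle lies in the kernel of restriction to `H` and
reduction modulo `I` exactly when `d(g) ≡ 1` modulo `I` for all `g ∈ H`. -/
theorem mk_mem_kerResRed_of_le {d : GLCocycle G S n} {H : Subgroup G} {I : Ideal S}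
    {hI : Stable H I} (hH : H ≤ inertiaGroup G I) :
    H1.mk _ d ∈ kerResRed n H I hI ↔
      ∀ g ∈ H, ∀ i j, mat d g i j - (1 : Matrix (Fin n) (Fin n) S) i j ∈ I := by
  have triv (g : H) (x : GL (Fin n) (S ⧸ I)) :
      glAction n (quotAction H I hI) (.op g) x = x := by
    apply Matrix.GeneralLinearGroup.ext
    intro i j
    obtain ⟨s, hs⟩ := Ideal.Quotient.mk_surjective (x i j)
    change quotAction H I hI (.op g) (x i j) = x i j
    rw [← hs]
    exact Ideal.Quotient.eq.mpr (mem_inertiaGroup.mp (hH g.2) s)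
  have key (g : G) : Matrix.GeneralLinearGroup.map (Ideal.Quotient.mk I) (d.1 g) = 1 ↔
      ∀ i j, mat d g i j - (1 : Matrix (Fin n) (Fin n) S) i j ∈ I := by
    rw [Matrix.GeneralLinearGroup.ext_iff]
    refine forall₂_congr fun i j => ?_
    rw [← Ideal.Quotient.eq]
    have h1 : Ideal.Quotient.mk I ((1 : Matrix (Fin n) (Fin n) S) i j) =
        (1 : Matrix (Fin n) (Fin n) (S ⧸ I)) i j := by
      rw [Matrix.one_apply, Matrix.one_apply, apply_ite (Ideal.Quotient.mk I), map_one, map_zero]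
    rw [h1]
    rfl
  rw [mk_mem_kerResRed]
  simp only [triv, mul_inv_cancel, exists_const]
  exact ⟨fun h g hg => (key g).mp (h ⟨g, hg⟩), fun h g => (key g).mpr (h g g.2)⟩

theorem mk_mem_kerRhoInertia {d : GLCocycle G S n} {M : MaximalSpectrum S} :
    H1.mk _ d ∈ kerRhoInertia n M ↔ ∀ g ∈ inertiaGroup G M.asIdeal,
      ∀ i j, mat d g i j - (1 : Matrix (Fin n) (Fin n) S) i j ∈ M.asIdeal :=
  mk_mem_kerResRed_of_le le_rfl

theorem mk_mem_kerRhoSubgroup {d : GLCocycle G S n} {H : Subgroup G} :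
    H1.mk _ d ∈ kerRhoSubgroup n H ↔ ∀ g ∈ H, ∀ M : MaximalSpectrum S,
      H ≤ inertiaGroup G M.asIdeal →
        ∀ i j, mat d g i j - (1 : Matrix (Fin n) (Fin n) S) i j ∈ M.asIdeal := by
  refine (mk_mem_kerResRed_of_le (le_inertiaGroup_J H)).trans ?_
  simp only [J, Ideal.mem_iInf]
  exact ⟨fun h g hg M hM i j => h g hg i j M hM, fun h g hg i j M hM => h g hg M hM i j⟩

theorem exists_mk (c : H1GL S G n) : ∃ d : GLCocycle G S n, H1.mk _ d = c :=
  Quotient.exists_rep c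

theorem iInter_kerRhoSubgroup_subset_inertia :
    (⋂ C ∈ {C : Subgroup G | IsCyclic C}, kerRhoSubgroup (S := S) n C) ⊆
      ⋂ M : MaximalSpectrum S, kerRhoInertia (G := G) n M := by
  intro c hc
  obtain ⟨d, rfl⟩ := exists_mk c
  simp only [Set.mem_iInter, mk_mem_kerRhoInertia, mk_mem_kerRhoSubgroup, Set.mem_ofPred_eq] at hc ⊢
  intro M g hg
  exact hc (Subgroup.zpowers g) inferInstance g (Subgroup.mem_zpowers g) M
    (by rwa [Subgroup.zpowers_le])

theorem iInter_inertia_subset_kerRhoSubgroup :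
    (⋂ M : MaximalSpectrum S, kerRhoInertia (G := G) n M) ⊆
      ⋂ H : Subgroup G, kerRhoSubgroup (S := S) n H := by
  intro c hc
  obtain ⟨d, rfl⟩ := exists_mk c
  simp only [Set.mem_iInter, mk_mem_kerRhoInertia, mk_mem_kerRhoSubgroup] at hc ⊢
  exact fun H g hg M hM => hc M g (hM hg)

theorem inertiaGroup_le_decompositionGroup (M : Ideal S) :
    inertiaGroup G M ≤ decompositionGroup G M := by
  have key : ∀ g ∈ inertiaGroup G M, MulOpposite.op g • M ≤ M := by
    intro g hg s hs
    rw [Ideal.mem_pointwise_smul_iff_inv_smul_mem] at hs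
    simpa using stable_inertiaGroup M g hg _ hs
  intro g hg
  refine mem_decompositionGroup.mpr (le_antisymm (key g hg) ?_)
  rw [← Ideal.pointwise_smul_le_pointwise_smul_iff (a := (MulOpposite.op g)⁻¹), inv_smul_smul]
  exact key _ (inv_mem hg)

theorem kerRhoDecomposition_subset_kerRhoInertia (M : MaximalSpectrum S) :
    kerRhoDecomposition (G := G) n M ⊆ kerRhoInertia n M := by
  intro c hc
  obtain ⟨d, rfl⟩ := exists_mk c
  obtain ⟨x, hx⟩ := mk_mem_kerResRed.mp hc
  refine mk_mem_kerResRed.mpr ⟨x, fun g => ?_⟩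
  refine (hx ⟨g, inertiaGroup_le_decompositionGroup _ g.2⟩).trans ?_
  congr 1

/-! ### Invariant vectors generate -/

/-- The character `s ↦ s ^ g mod M` of the monoid `S` with values in the field `S / M`. -/
def character (M : Ideal S) (g : G) : S →* S ⧸ M :=
  ((Ideal.Quotient.mk M).comp (ringAction G S (.op g)) : S →+* S ⧸ M)

theorem character_apply (M : Ideal S) (g : G) (s : S) :
    character M g s = Ideal.Quotient.mk M (MulOpposite.op g • s) := rfl

theorem character_mul_of_mem {M : Ideal S} {t : G} (ht : t ∈ inertiaGroup G M) (g : G) :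
    character M (g * t) = character M g := by
  ext s
  rw [character_apply, character_apply, MulOpposite.op_mul, mul_smul]
  exact Ideal.Quotient.eq.mpr (mem_inertiaGroup.mp ht _)

theorem character_eq_iff {M : Ideal S} {g h : G} :
    character M g = character M h ↔ h⁻¹ * g ∈ inertiaGroup G M := by
  constructor
  · intro e
    refine mem_inertiaGroup.mpr fun s => Ideal.Quotient.eq.mp ?_
    have := DFunLike.congr_fun e (MulOpposite.op h⁻¹ • s)
    rw [character_apply, character_apply, smul_smul, smul_smul] at this
    simpa using this
  · intro e
    rw [← character_mul_of_mem e h, mul_inv_cancel_left]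

open Classical in
/-- Dedekind's lemma for the characters `s ↦ s ^ g mod M`: the only repetitions are within the
left cosets of the inertia group. An element of trace `1` makes the order of the inertia group
invertible modulo `M`, so no cancellation inside a coset is possible. -/
theorem eq_zero_of_sum_character_eq_zero [Fintype G]
    (htr : ∃ x : S, ∑ g : G, MulOpposite.op g • x = 1) (M : Ideal S) [M.IsMaximal]
    (c : G → S ⧸ M) (hc : ∀ g, ∀ t ∈ inertiaGroup G M, c (g * t) = c g)
    (h : ∀ s, ∑ g, c g * character M g s = 0) (g₀ : G) : c g₀ = 0 := by
  set N : ℕ := (Finset.univ.filter fun g : G => g ∈ inertiaGroup G M).card with hN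
  have hfib (h : G) : (Finset.univ.filter fun g : G => character M g = character M h).card = N := by
    refine Finset.card_equiv (Equiv.mulLeft h⁻¹) fun g => ?_
    simp [character_eq_iff]
  have hgroup (a : G → S ⧸ M) (s : S) :
      ∑ χ ∈ Finset.univ.image (character M : G → S →* S ⧸ M),
        (∑ g with character M g = χ, a g) * χ s = ∑ g, a g * character M g s := by
    refine Eq.trans ?_ (Finset.sum_fiberwise_of_maps_to (s := Finset.univ)
      (t := Finset.univ.image (character M : G → S →* S ⧸ M)) (g := character M)
      (fun g hg => Finset.mem_image_of_mem _ hg) fun g => a g * character M g s)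
    refine Finset.sum_congr rfl fun χ _ => ?_
    rw [Finset.sum_mul]
    refine Finset.sum_congr rfl fun g hg => ?_
    rw [(Finset.mem_filter.mp hg).2]
  have hconst (a : G → S ⧸ M) (ha : ∀ g, ∀ t ∈ inertiaGroup G M, a (g * t) = a g) (h : G) :
      ∑ g with character M g = character M h, a g = N * a h := by
    rw [Finset.sum_congr rfl (g := fun _ => a h), Finset.sum_const, hfib, nsmul_eq_mul]
    intro g hg
    have := ha h _ (character_eq_iff.mp (Finset.mem_filter.mp hg).2)
    rwa [mul_inv_cancel_left] at this
  -- Modulo `M`, the trace of `x` is a multiple of the common size `N` of the fibers.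
  have hN0 : (N : S ⧸ M) ≠ 0 := by
    intro h0
    obtain ⟨x, hx⟩ := htr
    have h1 := congrArg (Ideal.Quotient.mk M) hx
    rw [map_sum, map_one] at h1
    have h2 := hgroup (fun _ => 1) x
    simp only [one_mul, character_apply] at h2
    rw [h1] at h2
    refine one_ne_zero (h2.symm.trans (Finset.sum_eq_zero fun χ hχ => ?_))
    obtain ⟨k, -, rfl⟩ := Finset.mem_image.mp hχ
    rw [hconst (fun _ => 1) (fun _ _ _ => rfl) k, h0, zero_mul, zero_mul]
  have hli := linearIndependent_iff'.mp (linearIndependent_monoidHom S (S ⧸ M))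
    (Finset.univ.image (character M : G → S →* S ⧸ M))
    (fun χ => ∑ g with character M g = χ, c g) (by
      funext s
      simpa [Finset.sum_apply] using (hgroup c s).trans (h s))
    (character M g₀) (Finset.mem_image_of_mem _ (Finset.mem_univ _))
  rw [hconst c hc g₀] at hli
  exact (mul_eq_zero.mp hli).resolve_left hN0

/-- If a cocycle is trivial modulo every maximal ideal on the corresponding inertia group, its
invariant vectors generate: otherwise some nonzero functional `S ^ n → S / M` vanishes on all
traces `∑ s ^ g e_i d(g)`, which contradicts the independence of characters. -/
theorem spans_of_mem_inertia [Fintype G]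
    (htr : ∃ x : S, ∑ g : G, MulOpposite.op g • x = 1) {d : GLCocycle G S n}
    (hd : ∀ M : MaximalSpectrum S, H1.mk _ d ∈ kerRhoInertia n M) : Spans d := by
  by_contra hne
  obtain ⟨P, hP, hle⟩ := (eq_top_or_exists_le_coatom
    (Submodule.span S (invariants d : Set (Fin n → S)))).resolve_left hne
  obtain ⟨M, hM, ⟨e⟩⟩ := isSimpleModule_iff_quot_maximal.mp (isSimpleModule_iff_isCoatom.mpr hP)
  -- `S ^ n / P` is simple, hence `S / M`, so `l` is a surjective functional killing all invariants.
  let l : (Fin n → S) →ₗ[S] S ⧸ M := e.toLinearMap ∘ₗ P.mkQ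
  have hl (v : Fin n → S) (hv : v ∈ invariants d) : l v = 0 := by
    have : P.mkQ v = 0 := by
      rw [Submodule.mkQ_apply, Submodule.Quotient.mk_eq_zero]
      exact hle (Submodule.subset_span hv)
    simp [l, this]
  have hlM (v : Fin n → S) (hv : ∀ j, v j ∈ M) : l v = 0 := by
    rw [pi_eq_sum_univ' v, map_sum]
    refine Finset.sum_eq_zero fun j _ => ?_
    rw [map_smul, Algebra.smul_def, Ideal.Quotient.algebraMap_eq,
      Ideal.Quotient.eq_zero_iff_mem.mpr (hv j), zero_mul]
  have hsingle (i : Fin n) : l (Pi.single i 1) = 0 := by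
    have hrow := eq_zero_of_sum_character_eq_zero htr M (fun g => l (mat d g i)) ?_ ?_ 1
    · rw [mat_one] at hrow
      rwa [← twist_one d (Pi.single i 1), twist_single, mat_one]
    -- The coefficients are constant on cosets: `d(g t) = d(g) ^ t d(t) ≡ d(g)` modulo `M`.
    · intro g t ht
      rw [← sub_eq_zero, ← map_sub]
      refine hlM _ fun j => ?_
      have hstep : mat d (g * t) i = (MulOpposite.op t • mat d g i) ᵥ* mat d t := by
        rw [← twist_single, ← twist_twist, twist_single, twist_apply]
      have hmt (k : Fin n) : Ideal.Quotient.mk M (mat d t k j) =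
          Ideal.Quotient.mk M ((1 : Matrix (Fin n) (Fin n) S) k j) :=
        Ideal.Quotient.eq.mpr (mk_mem_kerRhoInertia.mp (hd ⟨M, hM⟩) t ht k j)
      rw [Pi.sub_apply, ← Ideal.Quotient.eq, hstep, vecMul, dotProduct, map_sum]
      simp_rw [map_mul, hmt, ← map_mul, ← map_sum]
      have : ∑ k, (MulOpposite.op t • mat d g i) k * (1 : Matrix (Fin n) (Fin n) S) k j =
          MulOpposite.op t • mat d g i j := by
        simp [Matrix.one_apply]
      rw [this]
      exact Ideal.Quotient.eq.mpr (mem_inertiaGroup.mp ht _)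
    -- The linear relation between the characters is the vanishing of `l` on the trace of `s e_i`.
    · intro s
      have h0 := hl _ (sum_twist_mem_invariants d (s • Pi.single i 1))
      rw [map_sum] at h0
      rw [← h0]
      refine Finset.sum_congr rfl fun g _ => ?_
      rw [twist_smul, twist_single, map_smul, mul_comm, Algebra.smul_def]
      rfl
  have hzero : l = 0 := by
    ext i
    simpa using hsingle i
  have hsurj : Function.Surjective l := e.surjective.comp P.mkQ_surjective
  obtain ⟨v, hv⟩ := hsurj 1
  rw [hzero, LinearMap.zero_apply] at hv
  exact zero_ne_one hv

theorem exists_isUnit_of_span_eq_top {K : Type*} [Field K] {T : Set (Fin n → K)}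
    (hT : Submodule.span K T = ⊤) :
    ∃ w : Fin n → Fin n → K, (∀ i, w i ∈ T) ∧ IsUnit (Matrix.of w) := by
  obtain ⟨b, hbT, hbspan, hb⟩ := exists_linearIndependent K T
  let B : Module.Basis b K (Fin n → K) :=
    Module.Basis.mk hb (by rw [Subtype.range_coe, hbspan, hT])
  let e : b ≃ Fin n := B.indexEquiv (Pi.basisFun K (Fin n))
  refine ⟨fun i => (e.symm i : b), fun i => hbT (e.symm i).2, ?_⟩
  exact Matrix.linearIndependent_rows_iff_isUnit.mp (hb.comp _ e.symm.injective)

/-- If the invariant vectors generate, `n` of them reduce to a basis modulo `M`, and the matrix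
with these rows trivializes the cocycle modulo `M`. -/
theorem Spans.mem_kerRhoDecomposition {d : GLCocycle G S n} (hd : Spans d)
    (M : MaximalSpectrum S) : H1.mk _ d ∈ kerRhoDecomposition n M := by
  have hmax := M.isMaximal
  set K := S ⧸ M.asIdeal
  set π : S →+* K := Ideal.Quotient.mk M.asIdeal with hπ
  let red : (Fin n → S) → (Fin n → K) := fun v => π ∘ v
  have hspan : Submodule.span K (red '' (invariants d : Set (Fin n → S))) = ⊤ := by
    have hall (v : Fin n → S) (hv : v ∈ Submodule.span S (invariants d : Set (Fin n → S))) :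
        red v ∈ Submodule.span K (red '' (invariants d : Set (Fin n → S))) := by
      induction hv using Submodule.span_induction with
      | mem v hv => exact Submodule.subset_span ⟨v, hv, rfl⟩
      | zero => convert Submodule.zero_mem _; ext; simp [red]
      | add v w _ _ hv hw => convert Submodule.add_mem _ hv hw using 1; ext; simp [red]
      | smul s v _ hv => convert Submodule.smul_mem _ (π s) hv using 1; ext; simp [red]
    rw [eq_top_iff]
    intro w _
    choose v hv using fun j => Ideal.Quotient.mk_surjective (w j)
    have : red v = w := funext hv
    rw [← this]
    exact hall v (hd ▸ Submodule.mem_top)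
  obtain ⟨w, hwT, hw⟩ :=
    @exists_isUnit_of_span_eq_top n K (Ideal.Quotient.field M.asIdeal) _ hspan
  choose q hq hqw using hwT
  let X : Matrix (Fin n) (Fin n) S := Matrix.of q
  have hX : IsUnit (X.map π) := by
    rwa [show X.map π = Matrix.of w from funext hqw]
  obtain ⟨x, hx⟩ := hX
  -- Invariance of the rows reads `X ^ g d(g) = X`.
  refine mk_mem_kerResRed.mpr ⟨x⁻¹, fun g => ?_⟩
  rw [map_inv, inv_inv, eq_inv_mul_iff_mul_eq]
  apply Units.ext
  rw [Units.val_mul, hx]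
  have hx' : (glAction n (quotAction _ _ (stable_decompositionGroup M.asIdeal)) (.op g) x).1 =
      (X.map (MulOpposite.op (g : G) • ·)).map π := by
    ext i j
    change quotAction _ _ (stable_decompositionGroup M.asIdeal) (.op g) (x.1 i j) = _
    rw [hx]
    rfl
  rw [hx']
  change (X.map (MulOpposite.op (g : G) • ·)).map π * (mat d g).map π = X.map π
  rw [← Matrix.map_mul]
  congr 1
  ext i j
  exact congrFun (hq i g) j

theorem iInter_kerRhoDecomposition_eq [Fintype G]
    (htr : ∃ x : S, ∑ g : G, MulOpposite.op g • x = 1) :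
    (⋂ M : MaximalSpectrum S, kerRhoDecomposition (G := G) n M) =
      ⋂ M : MaximalSpectrum S, kerRhoInertia (G := G) n M := by
  refine (Set.iInter_mono kerRhoDecomposition_subset_kerRhoInertia).antisymm fun c hc => ?_
  obtain ⟨d, rfl⟩ := exists_mk c
  rw [Set.mem_iInter] at hc ⊢
  exact (spans_of_mem_inertia htr hc).mem_kerRhoDecomposition

theorem mk_mem_iInter_kerRhoDecomposition_iff [Fintype G]
    (htr : ∃ x : S, ∑ g : G, MulOpposite.op g • x = 1) {d : GLCocycle G S n} :
    H1.mk _ d ∈ (⋂ M : MaximalSpectrum S, kerRhoDecomposition (G := G) n M) ↔ Spans d := by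
  refine ⟨fun h => spans_of_mem_inertia htr ?_, fun h => ?_⟩
  · rwa [iInter_kerRhoDecomposition_eq htr, Set.mem_iInter] at h
  · exact Set.mem_iInter.mpr h.mem_kerRhoDecomposition

/-! ### The action on `S ⊗ Q` in coordinates -/

section Tensor

variable {Q : Type u} [AddCommGroup Q] [Module (Inv G S) Q]
  {Q' : Type u} [AddCommGroup Q'] [Module (Inv G S) Q']

theorem tensorAction_tmul (g : G) (s : S) (q : Q) :
    tensorAction g Q (s ⊗ₜ q) = (MulOpposite.op g • s) ⊗ₜ q := rfl

theorem tensorAction_smul (g : G) (s : S) (m : S ⊗[Inv G S] Q) :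
    tensorAction g Q (s • m) = (MulOpposite.op g • s) • tensorAction g Q m := by
  induction m with
  | zero => simp
  | add a b ha hb => rw [smul_add, map_add, ha, hb, map_add, smul_add]
  | tmul t q =>
    simp only [TensorProduct.smul_tmul', tensorAction_tmul, smul_eq_mul, smul_mul']

theorem tensorAction_mul (g h : G) (m : S ⊗[Inv G S] Q) :
    tensorAction (g * h) Q m = tensorAction h Q (tensorAction g Q m) := by
  induction m with
  | zero => simp
  | add a b ha hb => simp only [map_add, ha, hb]
  | tmul t q => simp only [tensorAction_tmul, MulOpposite.op_mul, mul_smul]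

theorem tensorAction_one (m : S ⊗[Inv G S] Q) : tensorAction (1 : G) Q m = m := by
  induction m with
  | zero => simp
  | add a b ha hb => simp only [map_add, ha, hb]
  | tmul t q => simp only [tensorAction_tmul, MulOpposite.op_one, one_smul]

theorem DescribesAction.equivFun_tensorAction {b : Module.Basis (Fin n) S (S ⊗[Inv G S] Q)}
    {d : GLCocycle G S n} (hd : DescribesAction b d) (g : G) (m : S ⊗[Inv G S] Q) :
    b.equivFun (tensorAction g Q m) = twist d g (b.equivFun m) := by
  conv_lhs => rw [← b.sum_equivFun m]
  simp_rw [map_sum, tensorAction_smul, map_smul]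
  ext k
  rw [twist_apply, vecMul, dotProduct, Finset.sum_apply]
  refine Finset.sum_congr rfl fun i _ => ?_
  rw [hd g i, map_sum]
  simp [Finsupp.single_apply]

/-- The action on `S ⊗ Q` is described, in any basis, by some cocycle. -/
theorem exists_describesAction (b : Module.Basis (Fin n) S (S ⊗[Inv G S] Q)) :
    ∃ d : GLCocycle G S n, DescribesAction b d := by
  let D (g : G) : Matrix (Fin n) (Fin n) S := Matrix.of fun i => b.equivFun (tensorAction g Q (b i))
  have hD (g : G) (i : Fin n) : tensorAction g Q (b i) = ∑ j, D g i j • b j :=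
    (b.sum_equivFun _).symm
  have hmul (g h : G) : D (g * h) = (D g).map (MulOpposite.op h • ·) * D h := by
    ext i k
    change b.equivFun (tensorAction (g * h) Q (b i)) k = _
    rw [tensorAction_mul, hD g i, map_sum, map_sum, Finset.sum_apply, mul_apply]
    refine Finset.sum_congr rfl fun j _ => ?_
    rw [tensorAction_smul, map_smul]
    rfl
  have hone : D 1 = 1 := by
    ext i k
    change b.equivFun (tensorAction 1 Q (b i)) k = _
    rw [tensorAction_one]
    simp [Matrix.one_apply]
  -- The cocycle identity for `g⁻¹ g = 1` gives a left inverse, which suffices for square matrices.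
  have hinv (g : G) : (D g⁻¹).map (MulOpposite.op g • ·) * D g = 1 := by
    rw [← hmul, inv_mul_cancel, hone]
  refine ⟨⟨fun g => ⟨D g, _, mul_eq_one_comm.mp (hinv g), hinv g⟩, fun g h => ?_⟩, hD⟩
  exact Units.ext (hmul g h)

theorem DescribesAction.spans {b : Module.Basis (Fin n) S (S ⊗[Inv G S] Q)}
    {d : GLCocycle G S n} (hd : DescribesAction b d) : Spans d := by
  have key (m : S ⊗[Inv G S] Q) :
      b.equivFun m ∈ Submodule.span S (invariants d : Set (Fin n → S)) := by
    induction m with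
    | zero => rw [map_zero]; exact Submodule.zero_mem _
    | add x y hx hy => rw [map_add]; exact Submodule.add_mem _ hx hy
    | tmul s q =>
      have : s ⊗ₜ[Inv G S] q = s • ((1 : S) ⊗ₜ q) := by simp [TensorProduct.smul_tmul']
      rw [this, map_smul]
      refine Submodule.smul_mem _ s (Submodule.subset_span fun g => ?_)
      rw [← hd.equivFun_tensorAction, tensorAction_tmul, smul_one]
  refine eq_top_iff.mpr fun v _ => ?_
  rw [← b.equivFun.apply_symm_apply v]
  exact key _

/-- Isomorphic modules give cohomologous cocycles, whatever the bases. -/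
theorem DescribesAction.cohomologous {b : Module.Basis (Fin n) S (S ⊗[Inv G S] Q)}
    {b' : Module.Basis (Fin n) S (S ⊗[Inv G S] Q')} {d d' : GLCocycle G S n}
    (hd : DescribesAction b d) (hd' : DescribesAction b' d') (e : Q ≃ₗ[Inv G S] Q') :
    Cohomologous _ d d' := by
  let φ : S ⊗[Inv G S] Q ≃ₗ[S] S ⊗[Inv G S] Q' := LinearEquiv.baseChange _ S _ _ e
  have hφ (g : G) (m : S ⊗[Inv G S] Q) : φ (tensorAction g Q m) = tensorAction g Q' (φ m) := by
    induction m with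
    | zero => simp
    | add x y hx hy => simp only [map_add, hx, hy]
    | tmul s q => rfl
  let X : Matrix (Fin n) (Fin n) S := Matrix.of fun i => b'.equivFun (φ (b i))
  let Y : Matrix (Fin n) (Fin n) S := Matrix.of fun i => b.equivFun (φ.symm (b' i))
  have hXY : X * Y = 1 := by
    ext i k
    have h1 : b.equivFun (φ.symm (φ (b i))) k = ∑ j, X i j * Y j k := by
      conv_lhs => rw [← b'.sum_equivFun (φ (b i))]
      rw [map_sum, map_sum, Finset.sum_apply]
      exact Finset.sum_congr rfl fun j _ => by rw [map_smul, map_smul]; rfl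
    rw [mul_apply, ← h1, φ.symm_apply_apply]
    simp [Matrix.one_apply]
  refine ⟨⟨X, Y, hXY, mul_eq_one_comm.mp hXY⟩, fun g => ?_⟩
  rw [eq_mul_inv_iff_mul_eq]
  apply Units.ext
  change mat d g * X = X.map (MulOpposite.op g • ·) * mat d' g
  ext i k
  have h1 : b'.equivFun (φ (tensorAction g Q (b i))) k = ∑ j, mat d g i j * X j k := by
    rw [hd g i, map_sum, map_sum, Finset.sum_apply]
    exact Finset.sum_congr rfl fun j _ => by rw [map_smul, map_smul]; rfl
  rw [mul_apply, ← h1, hφ, hd'.equivFun_tensorAction]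
  rfl

end Tensor

/-! ### Descent of invariants along the trace -/

section Trace

variable [Fintype G]

/-- The `S ^ G`-linear map `s ↦ ∑ (x s) ^ g` from `S` to `S ^ G`. -/
def weightedTrace (x : S) : S →ₗ[Inv G S] Inv G S where
  toFun s := ⟨∑ g : G, MulOpposite.op g • (x * s), fun h => by
    rw [Finset.smul_sum]
    simp_rw [smul_smul]
    exact Fintype.sum_equiv (Equiv.mulRight h.unop) _ _ fun g => rfl⟩
  map_add' s t := Subtype.ext (by simp [mul_add, Finset.sum_add_distrib])
  map_smul' r s := Subtype.ext (by
    change ∑ g : G, MulOpposite.op g • (x * ((r : S) * s)) =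
      (r : S) * ∑ g : G, MulOpposite.op g • (x * s)
    rw [Finset.mul_sum]
    refine Finset.sum_congr rfl fun g _ => ?_
    rw [mul_left_comm, smul_mul', r.2 (.op g)])

theorem coe_weightedTrace (x s : S) :
    (weightedTrace (G := G) x s : S) = ∑ g : G, MulOpposite.op g • (x * s) := rfl

theorem weightedTrace_one {x : S} (hx : ∑ g : G, MulOpposite.op g • x = 1) :
    weightedTrace (G := G) x 1 = 1 :=
  Subtype.ext (by rw [coe_weightedTrace, mul_one, hx]; rfl)

variable (Q : Type u) [AddCommGroup Q] [Module (Inv G S) Q]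
  {Q' : Type u} [AddCommGroup Q'] [Module (Inv G S) Q']

/-- The map `S ⊗ Q → Q`, `s ⊗ q ↦ (∑ (x s) ^ g) q`. -/
def traceRetraction (x : S) : S ⊗[Inv G S] Q →ₗ[Inv G S] Q :=
  (TensorProduct.lid (Inv G S) Q).toLinearMap ∘ₗ (weightedTrace (G := G) x).rTensor Q

variable {Q}

theorem traceRetraction_tmul (x s : S) (q : Q) :
    traceRetraction (G := G) Q x (s ⊗ₜ q) = weightedTrace (G := G) x s • q := by
  simp [traceRetraction]

theorem traceRetraction_one_tmul {x : S} (hx : ∑ g : G, MulOpposite.op g • x = 1) (q : Q) :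
    traceRetraction (G := G) Q x (1 ⊗ₜ q) = q := by
  rw [traceRetraction_tmul, weightedTrace_one hx, one_smul]

theorem one_tmul_traceRetraction (x : S) (m : S ⊗[Inv G S] Q) :
    (1 : S) ⊗ₜ[Inv G S] traceRetraction (G := G) Q x m = ∑ g, tensorAction g Q (x • m) := by
  induction m with
  | zero => simp
  | add a b ha hb =>
    simp only [map_add, TensorProduct.tmul_add, ha, hb, smul_add, Finset.sum_add_distrib]
  | tmul s q =>
    rw [traceRetraction_tmul, TensorProduct.tmul_smul, TensorProduct.smul_tmul']
    simp only [TensorProduct.smul_tmul', tensorAction_tmul, ← TensorProduct.sum_tmul]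
    congr 1
    rw [Subring.smul_def, coe_weightedTrace, smul_eq_mul, mul_one]
    rfl

/-- The invariants of `S ⊗ Q` come from `Q`. -/
theorem one_tmul_traceRetraction_of_invariant {x : S} (hx : ∑ g : G, MulOpposite.op g • x = 1)
    {m : S ⊗[Inv G S] Q} (hm : ∀ g : G, tensorAction g Q m = m) :
    (1 : S) ⊗ₜ[Inv G S] traceRetraction (G := G) Q x m = m := by
  rw [one_tmul_traceRetraction]
  simp_rw [tensorAction_smul, hm]
  rw [← Finset.sum_smul, hx, one_smul]

/-- An equivariant `S`-isomorphism `S ⊗ Q ≃ S ⊗ Q'` comes down to an isomorphism `Q ≃ Q'`. -/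
theorem nonempty_linearEquiv_of_equivariant
    (htr : ∃ x : S, ∑ g : G, MulOpposite.op g • x = 1)
    (φ : S ⊗[Inv G S] Q ≃ₗ[S] S ⊗[Inv G S] Q')
    (hφ : ∀ (g : G) m, φ (tensorAction g Q m) = tensorAction g Q' (φ m)) :
    Nonempty (Q ≃ₗ[Inv G S] Q') := by
  obtain ⟨x, hx⟩ := htr
  have hφ' (g : G) (m) : φ.symm (tensorAction g Q' m) = tensorAction g Q (φ.symm m) := by
    rw [LinearEquiv.symm_apply_eq, hφ, φ.apply_symm_apply]
  have hQ (q : Q) : (1 : S) ⊗ₜ[Inv G S] traceRetraction (G := G) Q' x (φ (1 ⊗ₜ q)) =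
      φ (1 ⊗ₜ q) :=
    one_tmul_traceRetraction_of_invariant hx fun g => by
      rw [← hφ, tensorAction_tmul, smul_one]
  have hQ' (q : Q') : (1 : S) ⊗ₜ[Inv G S] traceRetraction (G := G) Q x (φ.symm (1 ⊗ₜ q)) =
      φ.symm (1 ⊗ₜ q) :=
    one_tmul_traceRetraction_of_invariant hx fun g => by
      rw [← hφ', tensorAction_tmul, smul_one]
  refine ⟨LinearEquiv.ofLinearMap
    (traceRetraction Q' x ∘ₗ (φ.toLinearMap.restrictScalars (Inv G S)) ∘ₗ
      TensorProduct.mk (Inv G S) S Q 1)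
    (traceRetraction Q x ∘ₗ (φ.symm.toLinearMap.restrictScalars (Inv G S)) ∘ₗ
      TensorProduct.mk (Inv G S) S Q' 1) ?_ ?_⟩
  · ext q
    change traceRetraction Q' x (φ (1 ⊗ₜ traceRetraction Q x (φ.symm (1 ⊗ₜ q)))) = q
    rw [hQ', φ.apply_symm_apply, traceRetraction_one_tmul hx]
  · ext q
    change traceRetraction Q x (φ.symm (1 ⊗ₜ traceRetraction Q' x (φ (1 ⊗ₜ q)))) = q
    rw [hQ, φ.symm_apply_apply, traceRetraction_one_tmul hx]

theorem DescribesAction.nonempty_linearEquiv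
    (htr : ∃ x : S, ∑ g : G, MulOpposite.op g • x = 1)
    {b : Module.Basis (Fin n) S (S ⊗[Inv G S] Q)}
    {b' : Module.Basis (Fin n) S (S ⊗[Inv G S] Q')} {d d' : GLCocycle G S n}
    (hd : DescribesAction b d) (hd' : DescribesAction b' d') (h : Cohomologous _ d d') :
    Nonempty (Q ≃ₗ[Inv G S] Q') := by
  obtain ⟨X, hX⟩ := h
  have hX' (g : G) : mat d g * X.1 = X.1.map (MulOpposite.op g • ·) * mat d' g := by
    have := hX g
    rw [eq_mul_inv_iff_mul_eq] at this
    exact congrArg Units.val this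
  let ξ : (Fin n → S) ≃ₗ[S] (Fin n → S) := LinearEquiv.ofLinearMap
    (Matrix.vecMulLinear X.1) (Matrix.vecMulLinear X.2)
    (LinearMap.ext fun v => by
      change (v ᵥ* X.inv) ᵥ* X.val = v
      rw [vecMul_vecMul, X.inv_val, vecMul_one])
    (LinearMap.ext fun v => by
      change (v ᵥ* X.val) ᵥ* X.inv = v
      rw [vecMul_vecMul, X.val_inv, vecMul_one])
  have hξ (v) : ξ v = v ᵥ* X.1 := rfl
  refine nonempty_linearEquiv_of_equivariant htr (b.equivFun ≪≫ₗ ξ ≪≫ₗ b'.equivFun.symm)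
    fun g m => b'.equivFun.injective ?_
  simp only [LinearEquiv.trans_apply]
  rw [hd'.equivFun_tensorAction, LinearEquiv.apply_symm_apply, LinearEquiv.apply_symm_apply,
    hd.equivFun_tensorAction, hξ, hξ, twist_apply, twist_apply, op_smul_vecMul, vecMul_vecMul,
    vecMul_vecMul, hX']

end Trace

/-! ### Projective modules of invariant vectors -/

section Realization

variable [Fintype G]

instance : Algebra.IsInvariant (Inv G S) S Gᵐᵒᵖ where
  isInvariant s hs := ⟨⟨s, hs⟩, rfl⟩

theorem comap_inv_surjective :
    Function.Surjective (PrimeSpectrum.comap (algebraMap (Inv G S) S)) := by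
  have : Finite Gᵐᵒᵖ := .of_equiv G MulOpposite.opEquiv
  have : Algebra.IsIntegral (Inv G S) S := Algebra.IsInvariant.isIntegral (Inv G S) S Gᵐᵒᵖ
  exact Algebra.IsIntegral.comap_surjective _ _

/-- If finitely many invariant vectors `q` generate `S ^ n`, the surjection `S ^ m → S ^ n` they
define has an `S`-linear section taking invariant vectors to vectors over `S ^ G`. It is the
average, weighted by an element of trace `1`, of the conjugates of an arbitrary section. -/
theorem exists_equivariant_section (htr : ∃ x : S, ∑ g : G, MulOpposite.op g • x = 1)
    {d : GLCocycle G S n} {ι : Type*} [Fintype ι] (q : ι → Fin n → S)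
    (hq : ∀ k, q k ∈ invariants d) (hspan : Submodule.span S (Set.range q) = ⊤) :
    ∃ σ : (Fin n → S) →ₗ[S] (ι → S), (∀ v, ∑ k, σ v k • q k = v) ∧
      ∀ v ∈ invariants d, ∀ (g : G) (k : ι), MulOpposite.op g • σ v k = σ v k := by
  classical
  obtain ⟨x, hx⟩ := htr
  let p : (ι → S) →ₗ[S] (Fin n → S) := Fintype.linearCombination S q
  have hp : Function.Surjective p := by
    rw [← LinearMap.range_eq_top, Fintype.range_linearCombination, hspan]
  obtain ⟨τ, hτ⟩ := Module.projective_lifting_property p LinearMap.id hp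
  have hτ' (v : Fin n → S) : ∑ k, τ v k • q k = v := LinearMap.congr_fun hτ v
  -- The conjugate of `τ` by `g` is `v ↦ τ (v g⁻¹) ^ g`.
  refine ⟨{ toFun := fun v k => ∑ g, MulOpposite.op g • (x * τ (twist d g⁻¹ v) k)
            map_add' := fun v w => ?_
            map_smul' := fun s v => ?_ }, fun v => ?_, fun v hv h k => ?_⟩
  · ext k
    simp [mul_add, Finset.sum_add_distrib]
  · ext k
    simp only [twist_smul, map_smul, Pi.smul_apply, smul_eq_mul, RingHom.id_apply]
    rw [Finset.mul_sum]
    refine Finset.sum_congr rfl fun g _ => ?_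
    rw [mul_left_comm, smul_mul', smul_smul, ← MulOpposite.op_mul, inv_mul_cancel,
      MulOpposite.op_one, one_smul]
  · change ∑ k, (∑ g, MulOpposite.op g • (x * τ (twist d g⁻¹ v) k)) • q k = v
    simp_rw [Finset.sum_smul]
    rw [Finset.sum_comm]
    have hterm (g : G) : ∑ k, (MulOpposite.op g • (x * τ (twist d g⁻¹ v) k)) • q k =
        (MulOpposite.op g • x) • v := by
      calc ∑ k, (MulOpposite.op g • (x * τ (twist d g⁻¹ v) k)) • q k
          = twist d g (x • ∑ k, τ (twist d g⁻¹ v) k • q k) := by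
            rw [Finset.smul_sum, map_sum]
            refine Finset.sum_congr rfl fun k _ => ?_
            rw [smul_smul, twist_smul, hq k g]
        _ = (MulOpposite.op g • x) • v := by
            rw [hτ', twist_smul, twist_twist, inv_mul_cancel, twist_one]
    rw [Finset.sum_congr rfl fun g _ => hterm g, ← Finset.sum_smul, hx, one_smul]
  · change MulOpposite.op h • ∑ g, MulOpposite.op g • (x * τ (twist d g⁻¹ v) k) =
      ∑ g, MulOpposite.op g • (x * τ (twist d g⁻¹ v) k)
    simp_rw [hv _]
    exact (weightedTrace (G := G) x (τ v k)).2 (.op h)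

/-- A cocycle whose invariant vectors generate describes the action on `S ⊗ Q`, where `Q` is the
projective module of constant rank formed by these vectors. -/
theorem Spans.exists_describesAction (htr : ∃ x : S, ∑ g : G, MulOpposite.op g • x = 1)
    {d : GLCocycle G S n} (hd : Spans d) :
    ∃ (Q : ConstRankProj.Mod (Inv G S) n)
      (b : Module.Basis (Fin n) S (S ⊗[Inv G S] Q.carrier)), DescribesAction b d := by
  classical
  obtain ⟨F, hF, hFspan⟩ := (Submodule.fg_span_iff_fg_span_finset_subset
    (invariants d : Set (Fin n → S))).mp (hd.symm ▸ Module.Finite.fg_top)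
  let q : F → Fin n → S := fun k => k
  have hq (k : F) : q k ∈ invariants d := hF k.2
  have hspan : Submodule.span S (Set.range q) = ⊤ := by
    rw [show Set.range q = (F : Set (Fin n → S)) from Subtype.range_coe]
    exact hFspan.symm.trans hd
  obtain ⟨σ, hσ, hσinv⟩ := exists_equivariant_section htr q hq hspan
  let Q := invariants d
  let q' (k : F) : Q := ⟨q k, hq k⟩
  let c : Q →ₗ[Inv G S] (F → Inv G S) :=
    { toFun := fun v k => ⟨σ v k, fun g => hσinv v v.2 g.unop k⟩
      map_add' := fun v w => by ext k; simp
      map_smul' := fun r v => by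
        ext k
        change σ ((r : S) • (v : Fin n → S)) k = (r : S) * σ v k
        rw [map_smul]
        rfl }
  let p : (F → Inv G S) →ₗ[Inv G S] Q := Fintype.linearCombination (Inv G S) q'
  have hpc' (v : Q) : ∑ k, c v k • q' k = v := by
    apply Subtype.ext
    rw [Submodule.coe_sum]
    exact hσ v
  have hpc : p ∘ₗ c = LinearMap.id := LinearMap.ext hpc'
  have hfin : Module.Finite (Inv G S) Q := Module.Finite.of_surjective p fun v => ⟨c v, hpc' v⟩
  have hproj : Module.Projective (Inv G S) Q := Module.Projective.of_split c p hpc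
  let μ : S ⊗[Inv G S] Q →ₗ[S] (Fin n → S) := Q.subtype.liftBaseChange S
  have hμ (s : S) (v : Q) : μ (s ⊗ₜ v) = s • (v : Fin n → S) := by simp [μ]
  let ν : (Fin n → S) →ₗ[S] S ⊗[Inv G S] Q :=
    ∑ k, ((LinearMap.toSpanSingleton S _ ((1 : S) ⊗ₜ[Inv G S] q' k)) ∘ₗ LinearMap.proj k) ∘ₗ σ
  have hν (v : Fin n → S) : ν v = ∑ k, σ v k • ((1 : S) ⊗ₜ[Inv G S] q' k) := by
    simp [ν]
  let E : S ⊗[Inv G S] Q ≃ₗ[S] (Fin n → S) := LinearEquiv.ofLinearMap μ ν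
    (LinearMap.ext fun v => by
      simp only [LinearMap.comp_apply, hν, map_sum, map_smul, hμ, one_smul]
      exact hσ v)
    (by
      ext v
      change ν (μ (1 ⊗ₜ v)) = 1 ⊗ₜ v
      rw [hμ, one_smul, hν]
      conv_rhs => rw [← hpc' v, TensorProduct.tmul_sum]
      refine Finset.sum_congr rfl fun k _ => ?_
      rw [TensorProduct.tmul_smul]
      rfl)
  have hrank (P : PrimeSpectrum (Inv G S)) : Module.rankAtStalk Q P = n := by
    obtain ⟨P', rfl⟩ := comap_inv_surjective P
    rw [← Module.rankAtStalk_baseChange, Module.rankAtStalk_eq_of_equiv E]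
    have : Nontrivial S := P'.nontrivial
    simp
  refine ⟨{ carrier := Q, rank_eq := hrank }, Module.Basis.ofEquivFun E, fun g i => ?_⟩
  have hequiv (m : S ⊗[Inv G S] Q) : E (tensorAction g Q m) = twist d g (E m) := by
    change μ _ = twist d g (μ m)
    induction m with
    | zero => simp
    | add a b ha hb => simp only [map_add, ha, hb]
    | tmul s v => rw [tensorAction_tmul, hμ, hμ, twist_smul, v.2 g]
  refine E.injective ?_
  simp only [Module.Basis.coe_ofEquivFun]
  refine (hequiv _).trans ?_
  rw [E.apply_symm_apply, map_sum]
  simp only [map_smul, E.apply_symm_apply]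
  rw [twist_single]
  exact pi_eq_sum_univ' _

end Realization

/-! ### The classifying bijection -/

section Classification

open ConstRankProj

theorem nonempty_basis_of_mem_kerP {Q : Mod (Inv G S) n} (h : P.mk Q ∈ kerP G S n) :
    Nonempty (Module.Basis (Fin n) S (S ⊗[Inv G S] Q.carrier)) := by
  obtain ⟨e⟩ := Quotient.exact (s := ConstRankProj.setoid S n) h
  exact ⟨Module.Basis.ofEquivFun e⟩

theorem mk_mem_kerP {Q : Mod (Inv G S) n}
    (b : Module.Basis (Fin n) S (S ⊗[Inv G S] Q.carrier)) : P.mk Q ∈ kerP G S n :=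
  Quotient.sound (s := ConstRankProj.setoid S n) ⟨b.equivFun⟩

/-- The relation between isomorphism classes of modules and cohomology classes: some basis of
`S ⊗ Q` has its action described by a cocycle in the given class. -/
def Classifies (q : P n (Inv G S)) (c : H1GL S G n) : Prop :=
  ∃ (Q : Mod (Inv G S) n) (b : Module.Basis (Fin n) S (S ⊗[Inv G S] Q.carrier))
    (d : GLCocycle G S n), DescribesAction b d ∧ P.mk Q = q ∧ H1.mk _ d = c

theorem exists_classifies {q : P n (Inv G S)} (hq : q ∈ kerP G S n) :
    ∃ c : H1GL S G n, Classifies q c := by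
  obtain ⟨Q, rfl⟩ := Quotient.exists_rep q
  obtain ⟨b⟩ := nonempty_basis_of_mem_kerP hq
  obtain ⟨d, hd⟩ := exists_describesAction b
  exact ⟨_, Q, b, d, hd, rfl, rfl⟩

theorem Classifies.unique {q : P n (Inv G S)} {c c' : H1GL S G n} (h : Classifies q c)
    (h' : Classifies q c') : c = c' := by
  obtain ⟨Q, b, d, hd, rfl, rfl⟩ := h
  obtain ⟨Q', b', d', hd', hQ, rfl⟩ := h'
  obtain ⟨e⟩ := Quotient.exact (s := ConstRankProj.setoid _ n) hQ
  exact Quotient.sound (s := NonabH1.setoid _) (hd.cohomologous hd' e.symm)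

theorem Classifies.injective [Fintype G] (htr : ∃ x : S, ∑ g : G, MulOpposite.op g • x = 1)
    {q q' : P n (Inv G S)} {c : H1GL S G n} (h : Classifies q c) (h' : Classifies q' c) :
    q = q' := by
  obtain ⟨Q, b, d, hd, rfl, rfl⟩ := h
  obtain ⟨Q', b', d', hd', rfl, hc⟩ := h'
  exact Quotient.sound (s := ConstRankProj.setoid _ n)
    (hd.nonempty_linearEquiv htr hd' (Quotient.exact (s := NonabH1.setoid _) hc.symm))

theorem Classifies.mem_iInter {q : P n (Inv G S)} {c : H1GL S G n} (h : Classifies q c) :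
    c ∈ ⋂ M : MaximalSpectrum S, kerRhoDecomposition (G := G) n M := by
  obtain ⟨Q, b, d, hd, rfl, rfl⟩ := h
  exact Set.mem_iInter.mpr hd.spans.mem_kerRhoDecomposition

theorem exists_classifies_of_mem_iInter [Fintype G]
    (htr : ∃ x : S, ∑ g : G, MulOpposite.op g • x = 1) {c : H1GL S G n}
    (hc : c ∈ ⋂ M : MaximalSpectrum S, kerRhoDecomposition (G := G) n M) :
    ∃ q ∈ kerP G S n, Classifies q c := by
  obtain ⟨d, rfl⟩ := exists_mk c
  obtain ⟨Q, b, hb⟩ :=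
    ((mk_mem_iInter_kerRhoDecomposition_iff htr).mp hc).exists_describesAction htr
  exact ⟨_, mk_mem_kerP b, Q, b, d, hb, rfl, rfl⟩

theorem classifies_base :
    Classifies (P.base n (Inv G S)) (H1.base (glAction n (ringAction G S))) := by
  refine ⟨Mod.free _ n, (Pi.basisFun (Inv G S) (Fin n)).baseChange S, Z1.unit _,
    fun g i => ?_, rfl, rfl⟩
  have h1 (j : Fin n) : ((Z1.unit (glAction n (ringAction G S))).1 g :
      Matrix (Fin n) (Fin n) S) i j = (1 : Matrix (Fin n) (Fin n) S) i j := rfl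
  simp only [h1, Matrix.one_apply, ite_smul, one_smul, zero_smul, Finset.sum_ite_eq,
    Finset.mem_univ, if_true]
  refine (congrArg _ (Module.Basis.baseChange_apply S _ i)).trans ?_
  refine Eq.trans ?_ (Module.Basis.baseChange_apply S _ i).symm
  exact congrArg (· ⊗ₜ _) (smul_one _)

/-- The bijection from `Ker P_n(f)` to the intersection of the kernels, which sends the class of `Q`
to the class of the cocycle describing `S ⊗ Q`. The cocycle is chosen; `classifyingEquiv_eq` says
that the choice does not matter. -/
def classifyingEquiv [Fintype G] (htr : ∃ x : S, ∑ g : G, MulOpposite.op g • x = 1) :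
    kerP G S n ≃
      (⋂ M : MaximalSpectrum S, kerRhoDecomposition (G := G) n M : Set (H1GL S G n)) :=
  Equiv.ofBijective
    (fun q => ⟨(exists_classifies q.2).choose, (exists_classifies q.2).choose_spec.mem_iInter⟩) (by
      constructor
      · intro q q' h
        have hq' := (exists_classifies q'.2).choose_spec
        rw [← Subtype.mk.inj h] at hq'
        exact Subtype.ext ((exists_classifies q.2).choose_spec.injective htr hq')
      · rintro ⟨c, hc⟩
        obtain ⟨q, hq, h⟩ := exists_classifies_of_mem_iInter htr hc
        exact ⟨⟨q, hq⟩, Subtype.ext ((exists_classifies hq).choose_spec.unique h)⟩)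

theorem classifyingEquiv_eq [Fintype G] (htr : ∃ x : S, ∑ g : G, MulOpposite.op g • x = 1)
    {q : kerP G S n} {c : H1GL S G n} (h : Classifies q.1 c) :
    (classifyingEquiv htr q : H1GL S G n) = c :=
  (exists_classifies q.2).choose_spec.unique h

end Classification

end InvariantRing

end

open InvariantRing in
theorem proposition2p6
    {G : Type*} [Group G] [Fintype G] {S : Type*} [CommRing S] [MulSemiringAction Gᵐᵒᵖ S]
    (htr : ∃ x : S, ∑ g : G, MulOpposite.op g • x = 1) (n : ℕ) :
    (∃ Ψ : kerP G S n ≃ (⋂ M : MaximalSpectrum S, kerRhoDecomposition (G := G) n M :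
          Set (H1GL S G n)),
        (Ψ (kerPBase G S n) : H1GL S G n) = NonabH1.H1.base _ ∧
        ∀ (Q : ConstRankProj.Mod (Inv G S) n) (hQ : ConstRankProj.P.mk Q ∈ kerP G S n)
          (b : Module.Basis (Fin n) S (TensorProduct (Inv G S) S Q.carrier)),
          ∃ d : NonabH1.Z1 (glAction n (ringAction G S)),
            DescribesAction b d ∧
              (Ψ ⟨ConstRankProj.P.mk Q, hQ⟩ : H1GL S G n) = NonabH1.H1.mk _ d) ∧
      (⋂ M : MaximalSpectrum S, kerRhoDecomposition (G := G) n M) =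
        (⋂ M : MaximalSpectrum S, kerRhoInertia (G := G) n M) ∧
      (⋂ M : MaximalSpectrum S, kerRhoInertia (G := G) n M) =
        (⋂ C ∈ {C : Subgroup G | IsCyclic C}, kerRhoSubgroup (S := S) n C) ∧
      (⋂ C ∈ {C : Subgroup G | IsCyclic C}, kerRhoSubgroup (S := S) n C) =
        (⋂ H : Subgroup G, kerRhoSubgroup (S := S) n H) := by
  have hsub : (⋂ H : Subgroup G, kerRhoSubgroup (S := S) n H) ⊆
      ⋂ C ∈ {C : Subgroup G | IsCyclic C}, kerRhoSubgroup (S := S) n C :=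
    Set.subset_iInter₂ fun C _ => Set.iInter_subset _ C
  refine ⟨⟨classifyingEquiv htr, classifyingEquiv_eq htr classifies_base, fun Q hQ b => ?_⟩,
    iInter_kerRhoDecomposition_eq htr,
    (iInter_inertia_subset_kerRhoSubgroup.trans hsub).antisymm iInter_kerRhoSubgroup_subset_inertia,
    (iInter_kerRhoSubgroup_subset_inertia.trans iInter_inertia_subset_kerRhoSubgroup).antisymm hsub⟩
  obtain ⟨d, hd⟩ := exists_describesAction b
  exact ⟨d, hd, classifyingEquiv_eq htr ⟨Q, b, d, hd, rfl, rfl⟩⟩
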